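/- Let $C>0$ and let $(\alpha_n)_{n\ge 1}$ be real numbers with $0<\alpha_n<\min\{C,\tfrac12 n\}$ for all $n\ge1$. Let $S_0,S_1,S_2,\dots$ be the reflected random walk on $\{0,1,2,\dots\}$, i.e. the Markov chain with $S_0=1$ which from a state $n>0$ moves to $n+1$ with probability $\frac12+\frac{\alpha_n}{n}$ and to $n-1$ with probability $\frac12-\frac{\alpha_n}{n}$, and from the state $0$ moves to $1$ with probability $1$. Write $\ln_{(1)}x=\ln x$ and $\ln_{(k)}x=\ln_{(k-1)}(\ln x)$ for $k\ge2$. Call the walk transient if almost surely every state is visited only finitely often, and recurrent if almost surely every state is visited infinitely often. Then: (i) the walk is transient if there exist a real $c>1$ and integers $K\ge1$ and $n_0$ such that for all $n>n_0$ $$\alpha_n\ \ge\ \frac14\left(1+\sum_{k=1}^{K-1}\frac{1}{\prod_{j=1}^{k}\ln_{(j)}n}+\frac{c}{\prod_{j=1}^{K}\ln_{(j)}n}\right)$$ (an empty sum being $0$); (ii) the walk is recurrent if there exist integers $K\ge1$ and $n_0$ such that for all $n>n_0$ $$\alpha_n\ \le\ \frac14\left(1+\sum_{k=1}^{K}\frac{1}{\prod_{j=1}^{k}\ln_{(j)}n}\right).$$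 -/

import Mathlib

open MeasureTheory

/-- The `k`-fold iterated natural logarithm `ln_(k) x`: `ln_(1) x = ln x` and
`ln_(k) x = ln_(k-1) (ln x)`. -/
noncomputable def iterLog (k : ℕ) (x : ℝ) : ℝ := Real.log^[k] x

/-- The product `∏_{j=1}^{k} ln_(j) x`. -/
noncomputable def logProd (k : ℕ) (x : ℝ) : ℝ := ∏ j ∈ Finset.Icc 1 k, iterLog j x

/-- One-step transition probabilities of the reflected walk: from `0` the walk moves to `1`;
from `n > 0` it moves to `n + 1` with probability `1/2 + α n / n` and to `n - 1` with
probability `1/2 - α n / n`. -/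
noncomputable def stepProb (α : ℕ → ℝ) (n m : ℕ) : ℝ :=
  if n = 0 then (if m = 1 then 1 else 0)
  else if m = n + 1 then 1 / 2 + α n / n
  else if m + 1 = n then 1 / 2 - α n / n
  else 0

/-- The process `S` on the probability space `(Ω, P)` is the reflected random walk with
parameters `α` started at `1`: whatever the history `S 0 = h 0, …, S t = h t`, the next position
is `m` with conditional probability `stepProb α (h t) m` (written without division, so that
histories of probability zero impose nothing). -/
structure IsReflectedWalk {Ω : Type*} [MeasurableSpace Ω] (P : Measure Ω) (α : ℕ → ℝ)
    (S : ℕ → Ω → ℕ) : Prop where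
  measurable : ∀ t, Measurable (S t)
  start : ∀ᵐ ω ∂P, S 0 ω = 1
  step : ∀ (t : ℕ) (h : ℕ → ℕ) (m : ℕ),
    P.real {ω | (∀ s ≤ t, S s ω = h s) ∧ S (t + 1) ω = m} =
      P.real {ω | ∀ s ≤ t, S s ω = h s} * stepProb α (h t) m

/-- The process is recurrent: almost surely every state is visited infinitely often. -/
def IsRecurrentWalk {Ω : Type*} [MeasurableSpace Ω] (P : Measure Ω) (S : ℕ → Ω → ℕ) : Prop :=
  ∀ᵐ ω ∂P, ∀ i : ℕ, {t : ℕ | S t ω = i}.Infinite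

/-- The process is transient: almost surely every state is visited only finitely often. -/
def IsTransientWalk {Ω : Type*} [MeasurableSpace Ω] (P : Measure Ω) (S : ℕ → Ω → ℕ) : Prop :=
  ∀ᵐ ω ∂P, ∀ i : ℕ, {t : ℕ | S t ω = i}.Finite

/-! ### Iterated logarithms -/

/-! Let r_n be the ratio of the down and up probabilities at n. The function h(n) = ∑_{i<n} r_1⋯r_i
is strictly increasing, has increments at most 1, and is harmonic for the walk away from 0. The walk
is transient or recurrent according to whether h is bounded, that is, whether ∑ r_1⋯r_i converges.

Analysis: with y = 2α_n/n, log r_n = log((1-y)/(1+y)) is -4α_n/n up to a summable error. For the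
critical drift, 4α_n/n is the derivative of a sum of iterated logarithms, so r_1⋯r_n is compared, up
to constants, with 1/(n ln n ⋯ (ln_(K) n)^c). Its series converges for c > 1 and diverges for c = 1
(`summable_ratioProd`, `not_summable_ratioProd`).

Probability: h(S_t) is a submartingale with bounded increments, and subtracting the number of
earlier visits to 0 makes it a martingale. If h is bounded, h(S_t) converges almost surely, which a
path with steps ±1 can do only by leaving every state for good. If h is unbounded and 0 is visited
finitely often, the martingale is bounded below, hence almost surely above; then h(S_t), and so S_t,
is bounded. Then h(S_t) would converge, which is impossible for a bounded path with steps ±1. So 0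
recurs, and excursions from it reach every state. -/

theorem iterLog_zero (x : ℝ) : iterLog 0 x = x := rfl

theorem iterLog_succ (k : ℕ) (x : ℝ) : iterLog (k + 1) x = Real.log (iterLog k x) :=
  Function.iterate_succ_apply' _ _ _

theorem logProd_zero (x : ℝ) : logProd 0 x = 1 := by simp [logProd]

theorem logProd_succ (k : ℕ) (x : ℝ) : logProd (k + 1) x = logProd k x * iterLog (k + 1) x :=
  Finset.prod_Icc_succ_top (by omega) _

theorem tendsto_iterLog (k : ℕ) : Filter.Tendsto (iterLog k) Filter.atTop Filter.atTop := by
  induction k with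
  | zero => exact Filter.tendsto_id
  | succ k ih =>
    have : iterLog (k + 1) = Real.log ∘ iterLog k := funext (iterLog_succ k)
    rw [this]
    exact Real.tendsto_log_atTop.comp ih

/-- The first `K` iterated logarithms are at least `1` on a half-line. -/
theorem exists_one_le_iterLog (K : ℕ) :
    ∃ X : ℝ, ∀ x ≥ X, ∀ j ≤ K, 1 ≤ iterLog j x := by
  have h : ∀ᶠ x in Filter.atTop, ∀ j ∈ Set.Iic K, 1 ≤ iterLog j x :=
    (Set.finite_Iic K).eventually_all.2 fun j _ => (tendsto_iterLog j).eventually_ge_atTop 1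
  exact Filter.eventually_atTop.1 h

theorem one_le_logProd {k : ℕ} {x : ℝ} (h : ∀ j ≤ k, 1 ≤ iterLog j x) : 1 ≤ logProd k x := by
  simpa [logProd] using Finset.prod_le_prod (s := Finset.Icc 1 k) (f := fun _ => (1 : ℝ))
    (fun _ _ => zero_le_one) fun j hj => h j (Finset.mem_Icc.1 hj).2

theorem iterLog_le_iterLog {k : ℕ} {x y : ℝ} (h : ∀ j ≤ k, 1 ≤ iterLog j x) (hxy : x ≤ y) :
    iterLog k x ≤ iterLog k y := by
  induction k with
  | zero => exact hxy
  | succ k ih =>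
    rw [iterLog_succ, iterLog_succ]
    exact Real.log_le_log (zero_lt_one.trans_le (h k (by omega)))
      (ih fun j hj => h j (by omega))

theorem logProd_le_logProd {k : ℕ} {x y : ℝ} (h : ∀ j ≤ k, 1 ≤ iterLog j x) (hxy : x ≤ y) :
    logProd k x ≤ logProd k y := by
  refine Finset.prod_le_prod (fun j hj => ?_) fun j hj => ?_
  · exact zero_le_one.trans (h j (Finset.mem_Icc.1 hj).2)
  · exact iterLog_le_iterLog (fun i hi => h i (hi.trans (Finset.mem_Icc.1 hj).2)) hxy

theorem hasDerivAt_iterLog_succ {k : ℕ} {x : ℝ} (h : ∀ j ≤ k, 1 ≤ iterLog j x) :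
    HasDerivAt (iterLog (k + 1)) (1 / (x * logProd k x)) x := by
  have hfun : ∀ k, iterLog (k + 1) = fun y => Real.log (iterLog k y) :=
    fun k => funext (iterLog_succ k)
  induction k with
  | zero =>
    have hx : (1 : ℝ) ≤ x := h 0 le_rfl
    rw [hfun, logProd_zero, mul_one, one_div]
    exact Real.hasDerivAt_log (by positivity)
  | succ k ih =>
    have hk : 1 ≤ iterLog (k + 1) x := h (k + 1) le_rfl
    have := (ih fun j hj => h j (by omega)).log (by positivity)
    rw [hfun (k + 1), logProd_succ, ← mul_assoc, ← div_div]
    exact this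

/-! ### The critical drift and its primitive -/

/-- The critical drift of order `K + 1`, with constant `c` in its last term. -/
noncomputable def critDrift (c : ℝ) (K : ℕ) (x : ℝ) : ℝ :=
  1 + ∑ k ∈ Finset.Icc 1 K, 1 / logProd k x + c / logProd (K + 1) x

/-- A primitive of `critDrift c K x / x`. -/
noncomputable def critPrimitive (c : ℝ) (K : ℕ) (x : ℝ) : ℝ :=
  ∑ k ∈ Finset.range (K + 1), iterLog (k + 1) x + c * iterLog (K + 2) x

theorem hasDerivAt_critPrimitive {c : ℝ} {K : ℕ} {x : ℝ} (h : ∀ j ≤ K + 1, 1 ≤ iterLog j x) :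
    HasDerivAt (critPrimitive c K) (critDrift c K x / x) x := by
  have h1 : HasDerivAt (critPrimitive c K)
      (∑ k ∈ Finset.range (K + 1), 1 / (x * logProd k x)
        + c * (1 / (x * logProd (K + 1) x))) x := by
    refine HasDerivAt.add ?_ ((hasDerivAt_iterLog_succ h).const_mul c)
    refine HasDerivAt.fun_sum fun k hk => hasDerivAt_iterLog_succ fun j hj => h j ?_
    have := Finset.mem_range.1 hk
    omega
  convert h1 using 1
  have h2 : ∀ K, ∑ k ∈ Finset.range (K + 1), 1 / (x * logProd k x) =
      (1 + ∑ k ∈ Finset.Icc 1 K, 1 / logProd k x) / x := by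
    intro K
    induction K with
    | zero => simp [logProd_zero]
    | succ K ih =>
      rw [Finset.sum_range_succ, ih, Finset.sum_Icc_succ_top (by omega), mul_comm x, ← div_div]
      ring
  rw [h2, critDrift, add_div (1 + _), mul_one_div, mul_comm x, div_div]

theorem critDrift_div_anti {c : ℝ} (hc : 0 ≤ c) {K : ℕ} {x y : ℝ}
    (h : ∀ j ≤ K + 1, 1 ≤ iterLog j x) (hxy : x ≤ y) :
    critDrift c K y / y ≤ critDrift c K x / x := by
  have hx : (1 : ℝ) ≤ x := h 0 (by omega)
  have hP : ∀ k ≤ K + 1, 0 < logProd k x ∧ logProd k x ≤ logProd k y := fun k hk =>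
    ⟨zero_lt_one.trans_le (one_le_logProd fun j hj => h j (hj.trans hk)),
      logProd_le_logProd (fun j hj => h j (hj.trans hk)) hxy⟩
  have hsum : ∑ k ∈ Finset.Icc 1 K, 1 / logProd k y ≤ ∑ k ∈ Finset.Icc 1 K, 1 / logProd k x := by
    refine Finset.sum_le_sum fun k hk => ?_
    obtain ⟨h1, h2⟩ := hP k (by have := (Finset.mem_Icc.1 hk).2; omega)
    exact one_div_le_one_div_of_le h1 h2
  have hlast : c / logProd (K + 1) y ≤ c / logProd (K + 1) x :=
    div_le_div_of_nonneg_left hc (hP _ le_rfl).1 (hP _ le_rfl).2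
  have hnn : 0 ≤ critDrift c K x := by
    have h1 : 0 ≤ ∑ k ∈ Finset.Icc 1 K, 1 / logProd k x :=
      Finset.sum_nonneg fun k hk =>
        one_div_nonneg.2 (hP k (by have := (Finset.mem_Icc.1 hk).2; omega)).1.le
    have h2 : 0 ≤ c / logProd (K + 1) x := div_nonneg hc (hP _ le_rfl).1.le
    unfold critDrift
    linarith
  have hle : critDrift c K y ≤ critDrift c K x := by
    unfold critDrift
    linarith
  exact div_le_div₀ hnn hle (by positivity) hxy

theorem critPrimitive_mono {c : ℝ} (hc : 0 ≤ c) {K : ℕ} {x y : ℝ}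
    (h : ∀ j ≤ K + 2, 1 ≤ iterLog j x) (hxy : x ≤ y) :
    critPrimitive c K x ≤ critPrimitive c K y := by
  refine add_le_add (Finset.sum_le_sum fun k hk => ?_)
    (mul_le_mul_of_nonneg_left (iterLog_le_iterLog h hxy) hc)
  have := Finset.mem_range.1 hk
  exact iterLog_le_iterLog (fun j hj => h j (by omega)) hxy

/-- Exponentiating removes one logarithm from each term, which leaves the general term of Bertrand's
series. In this form it is visibly the derivative of an explicit function. -/
theorem exp_neg_critPrimitive {c : ℝ} {K : ℕ} {x : ℝ} (h : ∀ j ≤ K + 1, 1 ≤ iterLog j x) :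
    Real.exp (-critPrimitive c K x) =
      Real.exp (-((c - 1) * iterLog (K + 2) x)) * (1 / (x * logProd (K + 1) x)) := by
  have hlog : ∀ k ≤ K + 2, Real.exp (∑ i ∈ Finset.range k, iterLog (i + 1) x) =
      ∏ i ∈ Finset.range k, iterLog i x := by
    intro k hk
    rw [Real.exp_sum]
    refine Finset.prod_congr rfl fun i hi => ?_
    have := Finset.mem_range.1 hi
    rw [iterLog_succ, Real.exp_log (zero_lt_one.trans_le (h i (by omega)))]
  have hprod : ∀ k, ∏ i ∈ Finset.range (k + 1), iterLog i x = x * logProd k x := by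
    intro k
    induction k with
    | zero => simp [logProd_zero, iterLog_zero]
    | succ k ih => rw [Finset.prod_range_succ, ih, logProd_succ, mul_assoc]
  rw [← hprod, ← hlog _ le_rfl, one_div, ← Real.exp_neg, ← Real.exp_add, critPrimitive,
    Finset.sum_range_succ _ (K + 1)]
  congr 1
  ring

/-! ### Increments of functions with antitone derivative -/

/-- Mean value theorem; this replaces integral comparison, both for the Bertrand series and for sums
of the drift. -/
theorem increment_bounds_of_antitone_deriv {F g : ℝ → ℝ} {X : ℝ}
    (hF : ∀ x ≥ X, HasDerivAt F (g x) x) (hg : ∀ x ≥ X, ∀ y ≥ x, g y ≤ g x) {x : ℝ} (hx : X ≤ x) :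
    g (x + 1) ≤ F (x + 1) - F x ∧ F (x + 1) - F x ≤ g x := by
  obtain ⟨c, ⟨h1, h2⟩, hc⟩ := exists_hasDerivAt_eq_slope F g (lt_add_one x)
    (fun y hy => (hF y (hx.trans hy.1)).continuousAt.continuousWithinAt)
    (fun y hy => hF y (hx.trans hy.1.le))
  rw [add_sub_cancel_left, div_one] at hc
  rw [← hc]
  exact ⟨hg c (hx.trans h1.le) _ h2.le, hg x hx c h1.le⟩

theorem summable_of_le_telescope {u F : ℕ → ℝ} {N : ℕ} (hu : ∀ n, 0 ≤ u n) (hF : ∀ n, 0 ≤ F n)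
    (h : ∀ n ≥ N, u n ≤ F n - F (n + 1)) : Summable u := by
  rw [← summable_nat_add_iff N]
  refine summable_of_sum_range_le (c := F N) (fun n => hu _) fun n => ?_
  have : ∀ n, ∑ i ∈ Finset.range n, u (i + N) ≤ F N - F (n + N) := by
    intro n
    induction n with
    | zero => simp
    | succ n ih =>
      have := h (n + N) (by omega)
      rw [Finset.sum_range_succ, show n + 1 + N = n + N + 1 by ring]
      linarith
  linarith [this n, hF (n + N)]

theorem summable_exp_neg_critPrimitive {c : ℝ} (hc : 1 < c) (K : ℕ) :
    Summable fun n : ℕ => Real.exp (-critPrimitive c K (n + 1)) := by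
  obtain ⟨X, hX⟩ := exists_one_le_iterLog (K + 2)
  obtain ⟨N, hN⟩ := exists_nat_ge X
  have hc0 : 0 < c - 1 := sub_pos.2 hc
  have hder : ∀ x ≥ X, HasDerivAt
      (fun x => -(Real.exp (-((c - 1) * iterLog (K + 2) x)) / (c - 1)))
      (Real.exp (-critPrimitive c K x)) x := by
    intro x hx
    have h1 := (((hasDerivAt_iterLog_succ (k := K + 1)
      fun j hj => hX x hx j (by omega)).const_mul (c - 1)).neg.exp.div_const (c - 1)).neg
    rw [exp_neg_critPrimitive fun j hj => hX x hx j (by omega)]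
    refine HasDerivAt.congr_deriv h1 ?_
    change -(Real.exp (-((c - 1) * iterLog (K + 2) x)) *
      -((c - 1) * (1 / (x * logProd (K + 1) x))) / (c - 1)) = _
    rw [mul_neg, neg_div, neg_neg, mul_left_comm, mul_div_cancel_left₀ _ hc0.ne']
  refine summable_of_le_telescope (N := N)
    (F := fun n : ℕ => Real.exp (-((c - 1) * iterLog (K + 2) n)) / (c - 1))
    (fun n => (Real.exp_pos _).le) (fun n => by positivity) fun n hn => ?_
  have h2 := (increment_bounds_of_antitone_deriv hder (fun x hx y hy => Real.exp_le_exp.2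
    (neg_le_neg (critPrimitive_mono (by linarith) (hX x hx) hy)))
    (x := n) (hN.trans (by exact_mod_cast hn))).1
  push_cast
  linarith

theorem not_summable_exp_neg_critPrimitive (K : ℕ) :
    ¬ Summable fun n : ℕ => Real.exp (-critPrimitive 1 K n) := by
  intro hsum
  obtain ⟨X, hX⟩ := exists_one_le_iterLog (K + 2)
  obtain ⟨N, hN⟩ := exists_nat_ge X
  have hder : ∀ x ≥ X, HasDerivAt (iterLog (K + 2)) (Real.exp (-critPrimitive 1 K x)) x := by
    intro x hx
    rw [exp_neg_critPrimitive fun j hj => hX x hx j (by omega)]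
    simpa using hasDerivAt_iterLog_succ (k := K + 1) fun j hj => hX x hx j (by omega)
  have hstep : ∀ n : ℕ, iterLog (K + 2) ((n + N : ℕ) : ℝ) ≤ iterLog (K + 2) N +
      ∑ i ∈ Finset.range n, Real.exp (-critPrimitive 1 K ((i + N : ℕ) : ℝ)) := by
    intro n
    induction n with
    | zero => simp
    | succ n ih =>
      have h2 := (increment_bounds_of_antitone_deriv hder (fun x hx y hy => Real.exp_le_exp.2
        (neg_le_neg (critPrimitive_mono zero_le_one (hX x hx) hy)))
        (x := ((n + N : ℕ) : ℝ)) (hN.trans (by push_cast; linarith [n.cast_nonneg (α := ℝ)]))).2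
      rw [Finset.sum_range_succ, show ((n + 1 + N : ℕ) : ℝ) = ((n + N : ℕ) : ℝ) + 1 by
        push_cast; ring]
      linarith
  have hsum' := (summable_nat_add_iff N).2 hsum
  have htop : Filter.Tendsto (fun n : ℕ => iterLog (K + 2) ((n + N : ℕ) : ℝ))
      Filter.atTop Filter.atTop :=
    (tendsto_iterLog _).comp (tendsto_natCast_atTop_atTop.comp (Filter.tendsto_add_atTop_nat N))
  obtain ⟨n, hn⟩ := (htop.eventually_gt_atTop (iterLog (K + 2) N +
    ∑' i, Real.exp (-critPrimitive 1 K ((i + N : ℕ) : ℝ)))).exists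
  have := hsum'.sum_le_tsum (Finset.range n) fun i _ => (Real.exp_pos _).le
  linarith [hstep n]

/-! ### Weights of the harmonic function -/

/-- The ratio of the probabilities of a step down and a step up from `n`. -/
noncomputable def downUpRatio (α : ℕ → ℝ) (n : ℕ) : ℝ :=
  (1 / 2 - α n / n) / (1 / 2 + α n / n)

/-- The products of the first `n` ratios, which are the increments of the harmonic function. -/
noncomputable def ratioProd (α : ℕ → ℝ) (n : ℕ) : ℝ :=
  ∏ i ∈ Finset.range n, downUpRatio α (i + 1)

theorem ratioProd_succ (α : ℕ → ℝ) (n : ℕ) :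
    ratioProd α (n + 1) = ratioProd α n * downUpRatio α (n + 1) :=
  Finset.prod_range_succ _ _

/-- From log(1+x) ≥ 2x/(x+2) with 1+x = (1+y)/(1-y). There is no error term, so transience needs no
upper bound on α. -/
theorem log_ratio_le {y : ℝ} (h0 : 0 ≤ y) (h1 : y < 1) :
    Real.log ((1 - y) / (1 + y)) ≤ -(2 * y) := by
  have hy : 0 < 1 - y := sub_pos.2 h1
  have h := Real.le_log_one_add_of_nonneg (x := 2 * y / (1 - y)) (by positivity)
  have e1 : 2 * (2 * y / (1 - y)) / (2 * y / (1 - y) + 2) = 2 * y := by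
    field_simp
    ring
  have e2 : 1 + 2 * y / (1 - y) = ((1 - y) / (1 + y))⁻¹ := by
    field_simp
    ring
  rw [e1, e2, Real.log_inv] at h
  linarith

theorem le_log_ratio {y : ℝ} (h0 : 0 ≤ y) (h1 : y ≤ 1 / 2) :
    -(2 * y) - 2 * y ^ 2 ≤ Real.log ((1 - y) / (1 + y)) := by
  have hy : 0 < 1 - y := by linarith
  rw [Real.log_div hy.ne' (by positivity)]
  have h2 := Real.log_le_sub_one_of_pos (x := 1 + y) (by positivity)
  have h3 := Real.one_sub_inv_le_log_of_pos hy
  have h4 : (1 - y)⁻¹ ≤ 1 + y + 2 * y ^ 2 := by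
    rw [inv_le_iff_one_le_mul₀ hy]
    nlinarith [mul_nonneg (sq_nonneg y) (by linarith : 0 ≤ 1 - 2 * y)]
  linarith

theorem downUpRatio_eq (α : ℕ → ℝ) (n : ℕ) :
    downUpRatio α n = (1 - 2 * α n / n) / (1 + 2 * α n / n) := by
  rw [downUpRatio, ← mul_div_mul_left _ _ (two_ne_zero (α := ℝ))]
  congr 1 <;> ring

section Weights

variable {α : ℕ → ℝ}

theorem two_mul_div_mem_Ioo (hα : ∀ n : ℕ, 1 ≤ n → 0 < α n ∧ α n < (1 / 2 : ℝ) * n) {n : ℕ}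
    (hn : 1 ≤ n) : 0 < 2 * α n / n ∧ 2 * α n / n < 1 := by
  obtain ⟨h1, h2⟩ := hα n hn
  have h3 : (0 : ℝ) < n := by exact_mod_cast hn
  exact ⟨by positivity, by rw [div_lt_one h3]; linarith⟩

theorem downUpRatio_pos (hα : ∀ n : ℕ, 1 ≤ n → 0 < α n ∧ α n < (1 / 2 : ℝ) * n) {n : ℕ}
    (hn : 1 ≤ n) : 0 < downUpRatio α n := by
  obtain ⟨h1, h2⟩ := two_mul_div_mem_Ioo hα hn
  rw [downUpRatio_eq]
  exact div_pos (by linarith) (by linarith)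

theorem downUpRatio_le_one (hα : ∀ n : ℕ, 1 ≤ n → 0 < α n ∧ α n < (1 / 2 : ℝ) * n) {n : ℕ}
    (hn : 1 ≤ n) : downUpRatio α n ≤ 1 := by
  obtain ⟨h1, h2⟩ := two_mul_div_mem_Ioo hα hn
  rw [downUpRatio_eq, div_le_one (by linarith)]
  linarith

theorem ratioProd_pos (hα : ∀ n : ℕ, 1 ≤ n → 0 < α n ∧ α n < (1 / 2 : ℝ) * n) (n : ℕ) :
    0 < ratioProd α n :=
  Finset.prod_pos fun _ _ => downUpRatio_pos hα (by omega)

theorem ratioProd_le_one (hα : ∀ n : ℕ, 1 ≤ n → 0 < α n ∧ α n < (1 / 2 : ℝ) * n) (n : ℕ) :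
    ratioProd α n ≤ 1 :=
  Finset.prod_le_one (fun _ _ => (downUpRatio_pos hα (by omega)).le)
    fun _ _ => downUpRatio_le_one hα (by omega)

theorem log_ratioProd_succ (hα : ∀ n : ℕ, 1 ≤ n → 0 < α n ∧ α n < (1 / 2 : ℝ) * n) (n : ℕ) :
    Real.log (ratioProd α (n + 1)) =
      Real.log (ratioProd α n) + Real.log (downUpRatio α (n + 1)) := by
  rw [ratioProd_succ, Real.log_mul (ratioProd_pos hα n).ne' (downUpRatio_pos hα (by omega)).ne']

theorem summable_ratioProd (hα : ∀ n : ℕ, 1 ≤ n → 0 < α n ∧ α n < (1 / 2 : ℝ) * n)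
    {c : ℝ} (hc : 1 < c) {K n₀ : ℕ} (h : ∀ n : ℕ, n₀ < n → (1 / 4 : ℝ) * critDrift c K n ≤ α n) :
    Summable (ratioProd α) := by
  obtain ⟨X, hX⟩ := exists_one_le_iterLog (K + 2)
  obtain ⟨N, hN⟩ := exists_nat_ge (max X n₀)
  have hNX : X ≤ N := (le_max_left _ _).trans hN
  have hNn : n₀ ≤ N := by exact_mod_cast (le_max_right _ _).trans hN
  -- The left side is nonincreasing. The primitive is taken one step ahead because its increment
  -- over [m+1, m+2] is at most the antitone derivative at m+1, where the new ratio sits.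
  have hstep : ∀ n : ℕ, Real.log (ratioProd α (n + N)) + critPrimitive c K ((n + N : ℕ) + 1) ≤
      Real.log (ratioProd α N) + critPrimitive c K (N + 1) := by
    intro n
    induction n with
    | zero => simp
    | succ n ih =>
      set m := n + N with hm
      rw [show n + 1 + N = m + 1 by omega, log_ratioProd_succ hα]
      have hXm : X ≤ ((m + 1 : ℕ) : ℝ) := hNX.trans (by exact_mod_cast (by omega))
      have h1 := (increment_bounds_of_antitone_deriv
        (fun x hx => hasDerivAt_critPrimitive (c := c) (K := K) fun j hj => hX x hx j (by omega))
        (fun x hx y hy => critDrift_div_anti (by linarith) (fun j hj => hX x hx j (by omega)) hy)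
        hXm).2
      obtain ⟨h2, h3⟩ := two_mul_div_mem_Ioo hα (n := m + 1) (by omega)
      have h4 := log_ratio_le h2.le h3
      rw [← downUpRatio_eq] at h4
      have h5 : critDrift c K ((m + 1 : ℕ) : ℝ) / ((m + 1 : ℕ) : ℝ) ≤
          2 * (2 * α (m + 1) / ((m + 1 : ℕ) : ℝ)) := by
        rw [← mul_div_assoc]
        gcongr
        linarith [h (m + 1) (by omega)]
      push_cast at *
      linarith
  rw [← summable_nat_add_iff N]
  refine Summable.of_nonneg_of_le (fun n => (ratioProd_pos hα _).le) (fun n => ?_)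
    (((summable_nat_add_iff N).2 (summable_exp_neg_critPrimitive hc K)).mul_left
      (Real.exp (Real.log (ratioProd α N) + critPrimitive c K (N + 1))))
  rw [← Real.exp_log (ratioProd_pos hα (n + N)), ← Real.exp_add]
  exact Real.exp_le_exp.2 (by linarith [hstep n])

theorem not_summable_ratioProd {C : ℝ}
    (hα : ∀ n : ℕ, 1 ≤ n → 0 < α n ∧ α n < (1 / 2 : ℝ) * n) (hC : ∀ n : ℕ, 1 ≤ n → α n ≤ C)
    {K n₀ : ℕ} (h : ∀ n : ℕ, n₀ < n → α n ≤ (1 / 4 : ℝ) * critDrift 1 K n) :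
    ¬ Summable (ratioProd α) := by
  intro hsum
  obtain ⟨X, hX⟩ := exists_one_le_iterLog (K + 2)
  -- The bound 4C makes y = 2α_n/n at most 1/2, as `le_log_ratio` requires.
  obtain ⟨N, hN⟩ := exists_nat_ge (max (max X n₀) (max 1 (4 * C)))
  have hNX : X ≤ N := ((le_max_left _ _).trans (le_max_left _ _)).trans hN
  have hNn : n₀ ≤ N := by exact_mod_cast ((le_max_right _ _).trans (le_max_left _ _)).trans hN
  have hN1 : (1 : ℝ) ≤ N := ((le_max_left _ _).trans (le_max_right _ _)).trans hN
  have hNC : 4 * C ≤ N := ((le_max_right _ _).trans (le_max_right _ _)).trans hN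
  -- The quadratic error 2y² with y ≤ 2C/(m+1) is at most 8C²/(m(m+1)), which telescopes;
  -- subtracting 8C²/m makes the right side nondecreasing.
  have hstep : ∀ n : ℕ, Real.log (ratioProd α N) + critPrimitive 1 K N - 8 * C ^ 2 / N ≤
      Real.log (ratioProd α (n + N)) + critPrimitive 1 K (n + N : ℕ)
        - 8 * C ^ 2 / (n + N : ℕ) := by
    intro n
    induction n with
    | zero => simp
    | succ n ih =>
      set m := n + N with hm
      rw [show n + 1 + N = m + 1 by omega, log_ratioProd_succ hα]
      have hNm : (N : ℝ) ≤ m := by exact_mod_cast (by omega)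
      have hm0 : (0 : ℝ) < m := by linarith
      have h1 := (increment_bounds_of_antitone_deriv
        (fun x hx => hasDerivAt_critPrimitive (c := 1) (K := K) fun j hj => hX x hx j (by omega))
        (fun x hx y hy => critDrift_div_anti zero_le_one (fun j hj => hX x hx j (by omega)) hy)
        (hNX.trans hNm)).1
      have hα1 := (hα (m + 1) (by omega)).1
      have hC1 := hC (m + 1) (by omega)
      have h2 : 2 * α (m + 1) / ((m + 1 : ℕ) : ℝ) ≤ 1 / 2 := by
        rw [div_le_iff₀ (by positivity)]
        push_cast
        linarith
      have h4 := le_log_ratio (two_mul_div_mem_Ioo hα (n := m + 1) (by omega)).1.le h2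
      rw [← downUpRatio_eq] at h4
      have h5 : 2 * (2 * α (m + 1) / ((m + 1 : ℕ) : ℝ)) ≤
          critDrift 1 K ((m + 1 : ℕ) : ℝ) / ((m + 1 : ℕ) : ℝ) := by
        rw [← mul_div_assoc]
        gcongr
        linarith [h (m + 1) (by omega)]
      have h6 : 2 * (2 * α (m + 1) / ((m + 1 : ℕ) : ℝ)) ^ 2 ≤
          8 * C ^ 2 / m - 8 * C ^ 2 / ((m + 1 : ℕ) : ℝ) := by
        have e : 8 * C ^ 2 / (m : ℝ) - 8 * C ^ 2 / ((m + 1 : ℕ) : ℝ) =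
            8 * C ^ 2 / (m * ((m + 1 : ℕ) : ℝ)) := by
          push_cast
          field_simp
          ring
        rw [e, div_pow, ← mul_div_assoc]
        refine div_le_div₀ (by positivity) ?_ (by positivity) ?_
        · nlinarith
        · push_cast
          nlinarith
      push_cast at *
      linarith
  refine not_summable_exp_neg_critPrimitive K ((summable_nat_add_iff N).1 ?_)
  refine Summable.of_nonneg_of_le (fun n => (Real.exp_pos _).le) (fun n => ?_)
    (((summable_nat_add_iff N).2 hsum).mul_left
      (Real.exp (-(Real.log (ratioProd α N) + critPrimitive 1 K N - 8 * C ^ 2 / N))))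
  have hpos : 0 ≤ 8 * C ^ 2 / ((n + N : ℕ) : ℝ) := by positivity
  rw [← Real.exp_log (ratioProd_pos hα (n + N)), ← Real.exp_add]
  exact Real.exp_le_exp.2 (by linarith [hstep n])

end Weights

/-! ### The harmonic function -/

/-- The function with increments `ratioProd α`; it is harmonic for the walk away from `0`. -/
noncomputable def harmonicFn (α : ℕ → ℝ) (n : ℕ) : ℝ := ∑ i ∈ Finset.range n, ratioProd α i

theorem harmonicFn_zero (α : ℕ → ℝ) : harmonicFn α 0 = 0 := Finset.sum_range_zero _

theorem harmonicFn_succ (α : ℕ → ℝ) (n : ℕ) :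
    harmonicFn α (n + 1) = harmonicFn α n + ratioProd α n := Finset.sum_range_succ _ _

theorem harmonicFn_one (α : ℕ → ℝ) : harmonicFn α 1 = 1 := by simp [harmonicFn, ratioProd]

theorem harmonicFn_strictMono {α : ℕ → ℝ}
    (hα : ∀ n : ℕ, 1 ≤ n → 0 < α n ∧ α n < (1 / 2 : ℝ) * n) : StrictMono (harmonicFn α) :=
  strictMono_nat_of_lt_succ fun n => by
    rw [harmonicFn_succ]
    linarith [ratioProd_pos hα n]

theorem harmonicFn_nonneg {α : ℕ → ℝ}
    (hα : ∀ n : ℕ, 1 ≤ n → 0 < α n ∧ α n < (1 / 2 : ℝ) * n) (n : ℕ) : 0 ≤ harmonicFn α n :=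
  Finset.sum_nonneg fun _ _ => (ratioProd_pos hα _).le

theorem harmonicFn_harmonic {α : ℕ → ℝ}
    (hα : ∀ n : ℕ, 1 ≤ n → 0 < α n ∧ α n < (1 / 2 : ℝ) * n) (k : ℕ) :
    (1 / 2 + α (k + 1) / (k + 1 : ℕ)) * harmonicFn α (k + 2) +
      (1 / 2 - α (k + 1) / (k + 1 : ℕ)) * harmonicFn α k = harmonicFn α (k + 1) := by
  have h1 := (hα (k + 1) (by omega)).1
  have h2 : (0 : ℝ) < 1 / 2 + α (k + 1) / (k + 1 : ℕ) := by positivity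
  have h3 : (1 / 2 + α (k + 1) / (k + 1 : ℕ)) * downUpRatio α (k + 1) =
      1 / 2 - α (k + 1) / (k + 1 : ℕ) := mul_div_cancel₀ _ h2.ne'
  rw [harmonicFn_succ α (k + 1), harmonicFn_succ α k, ratioProd_succ]
  linear_combination ratioProd α k * h3

theorem abs_harmonicFn_sub_le {α : ℕ → ℝ}
    (hα : ∀ n : ℕ, 1 ≤ n → 0 < α n ∧ α n < (1 / 2 : ℝ) * n) {n m : ℕ}
    (h : m = n + 1 ∨ m + 1 = n) : |harmonicFn α m - harmonicFn α n| ≤ 1 := by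
  rcases h with rfl | rfl
  · rw [harmonicFn_succ, add_sub_cancel_left, abs_of_pos (ratioProd_pos hα n)]
    exact ratioProd_le_one hα n
  · rw [harmonicFn_succ, sub_add_cancel_left, abs_neg, abs_of_pos (ratioProd_pos hα m)]
    exact ratioProd_le_one hα m

/-! ### Paths with steps of size one -/

/-- Infinitely many visits to i force l = f i, but each visit is followed by a neighbour of i, where
f takes a different value. -/
theorem finite_setOf_eq_of_tendsto {s : ℕ → ℕ} (hs : ∀ t, s (t + 1) = s t + 1 ∨ s (t + 1) + 1 = s t)
    {f : ℕ → ℝ} (hf : StrictMono f) {l : ℝ}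
    (hl : Filter.Tendsto (fun t => f (s t)) Filter.atTop (nhds l)) (i : ℕ) :
    {t | s t = i}.Finite := by
  by_contra hinf
  have hfreq : ∃ᶠ t in Filter.atTop, s t = i := Nat.frequently_atTop_iff_infinite.2 hinf
  have hi : f i = l := by
    by_contra hne
    obtain ⟨t, ht1, ht2⟩ := (hfreq.and_eventually (hl.eventually_ne (Ne.symm hne))).exists
    exact ht2 (by rw [ht1])
  have hl' := hl.comp (Filter.tendsto_add_atTop_nat 1)
  have hup : ∀ᶠ t in Filter.atTop, f (s (t + 1)) ≠ f (i + 1) :=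
    hl'.eventually_ne (by rw [← hi]; exact (hf (Nat.lt_succ_self i)).ne)
  have hdown : ∀ᶠ t in Filter.atTop, s (t + 1) + 1 ≠ i := by
    by_cases h0 : i = 0
    · exact Filter.Eventually.of_forall fun t => by omega
    · have : ∀ᶠ t in Filter.atTop, f (s (t + 1)) ≠ f (i - 1) :=
        hl'.eventually_ne (by rw [← hi]; exact (hf (by omega : i - 1 < i)).ne')
      filter_upwards [this] with t ht h
      exact ht (by rw [show i - 1 = s (t + 1) by omega])
  obtain ⟨t, ht, h1, h2⟩ := (hfreq.and_eventually (hup.and hdown)).exists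
  rcases hs t with h | h
  · exact h1 (by rw [h, ht])
  · exact h2 (by rw [h, ht])

theorem not_tendsto_of_bounded {s : ℕ → ℕ} (hs : ∀ t, s (t + 1) = s t + 1 ∨ s (t + 1) + 1 = s t)
    {f : ℕ → ℝ} (hf : StrictMono f) {B : ℕ} (hB : ∀ t, s t ≤ B) (l : ℝ) :
    ¬ Filter.Tendsto (fun t => f (s t)) Filter.atTop (nhds l) := by
  intro hl
  have h : (⋃ i ∈ Set.Iic B, {t | s t = i}).Finite :=
    (Set.finite_Iic B).biUnion fun i _ => finite_setOf_eq_of_tendsto hs hf hl i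
  refine Set.infinite_univ (h.subset fun t _ => ?_)
  simpa using hB t

/-- Upward steps have size one, so the first time at or above i after a visit to 0 is a visit to i.
-/
theorem infinite_setOf_eq_of_unbounded {s : ℕ → ℕ}
    (hs : ∀ t, s (t + 1) = s t + 1 ∨ s (t + 1) + 1 = s t) (h0 : {t | s t = 0}.Infinite)
    (hunb : ∀ B, ∃ t, B < s t) (i : ℕ) : {t | s t = i}.Infinite := by
  rw [Set.infinite_iff_exists_gt]
  intro T
  obtain ⟨t₀, ht₀, hT⟩ := h0.exists_gt T
  have hex : ∃ u, i ≤ s (t₀ + u) := by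
    -- The sum dominates every position before t₀, which forces t ≥ t₀.
    obtain ⟨t, ht⟩ := hunb (i + ∑ j ∈ Finset.range t₀, s j)
    have hle : t₀ ≤ t := by
      by_contra hlt
      have := Finset.single_le_sum (f := s) (fun _ _ => Nat.zero_le _)
        (Finset.mem_range.2 (not_le.1 hlt))
      omega
    exact ⟨t - t₀, by rw [Nat.add_sub_cancel' hle]; omega⟩
  classical
  refine ⟨t₀ + Nat.find hex, ?_, by omega⟩
  have h1 := Nat.find_spec hex
  change s (t₀ + Nat.find hex) = i
  rcases Nat.eq_zero_or_pos (Nat.find hex) with hz | hpos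
  · have h2 : s t₀ = 0 := ht₀
    rw [hz, add_zero, h2] at h1 ⊢
    omega
  · have h2 := Nat.find_min hex (Nat.sub_lt hpos one_pos)
    have h3 := hs (t₀ + (Nat.find hex - 1))
    rw [show t₀ + (Nat.find hex - 1) + 1 = t₀ + Nat.find hex by omega] at h3
    omega

/-! ### Martingales of the walk -/

namespace IsReflectedWalk

variable {Ω : Type*} {S : ℕ → Ω → ℕ}

/-- The set of paths with history `h` up to time `t`. -/
abbrev cylinder (S : ℕ → Ω → ℕ) (t : ℕ) (h : ℕ → ℕ) : Set Ω := {ω | ∀ s ≤ t, S s ω = h s}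

/-- Indexing by finite tuples keeps the union countable; the padding by 0 after time t is
irrelevant. -/
theorem iUnion_cylinder (S : ℕ → Ω → ℕ) (t : ℕ) :
    ⋃ g : Fin (t + 1) → ℕ, cylinder S t (fun s => if hs : s < t + 1 then g ⟨s, hs⟩ else 0) =
      Set.univ := by
  refine Set.eq_univ_of_forall fun ω => Set.mem_iUnion.2 ⟨fun s => S s ω, fun s hs => ?_⟩
  simp only [Nat.lt_succ_of_le hs, dif_pos]

/-- The indicator of a visit to `0` at time `t`. -/
noncomputable def atZero (S : ℕ → Ω → ℕ) (t : ℕ) (ω : Ω) : ℝ := if S t ω = 0 then 1 else 0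

theorem atZero_nonneg (S : ℕ → Ω → ℕ) (t : ℕ) (ω : Ω) : 0 ≤ atZero S t ω := by
  unfold atZero
  split_ifs <;> norm_num

theorem atZero_le_one (S : ℕ → Ω → ℕ) (t : ℕ) (ω : Ω) : atZero S t ω ≤ 1 := by
  unfold atZero
  split_ifs <;> norm_num

variable {m : MeasurableSpace Ω} {P : Measure Ω} {α : ℕ → ℝ}

theorem measurableSet_cylinder (hS : IsReflectedWalk P α S) (t : ℕ) (h : ℕ → ℕ) :
    MeasurableSet (cylinder S t h) := by
  have : cylinder S t h = ⋂ s, ⋂ _ : s ≤ t, S s ⁻¹' {h s} := by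
    ext ω
    simp
  rw [this]
  exact .iInter fun s => .iInter fun _ => hS.measurable s (measurableSet_singleton _)

/-- A property holding almost surely on each history up to time `t` holds almost surely. -/
theorem ae_of_ae_cylinder {t : ℕ} {p : Ω → Prop}
    (h : ∀ g : ℕ → ℕ, ∀ᵐ ω ∂P, ω ∈ cylinder S t g → p ω) : ∀ᵐ ω ∂P, p ω := by
  filter_upwards [ae_all_iff.2 fun g : Fin (t + 1) → ℕ =>
    h fun s => if hs : s < t + 1 then g ⟨s, hs⟩ else 0] with ω hω
  obtain ⟨g, hg⟩ := Set.mem_iUnion.1 ((iUnion_cylinder S t).symm ▸ Set.mem_univ ω)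
  exact hω g hg

theorem ae_step [IsProbabilityMeasure P] (hS : IsReflectedWalk P α S) :
    ∀ᵐ ω ∂P, ∀ t, S (t + 1) ω = S t ω + 1 ∨ S (t + 1) ω + 1 = S t ω := by
  refine ae_all_iff.2 fun t => ae_of_ae_cylinder (S := S) (t := t) fun g => ?_
  have hnull : ∀ m : ℕ, ¬ (m = g t + 1 ∨ m + 1 = g t) →
      ∀ᵐ ω ∂P, ¬ (ω ∈ cylinder S t g ∧ S (t + 1) ω = m) := by
    intro m hm
    have h1 := hS.step t g m
    have h2 : stepProb α (g t) m = 0 := by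
      unfold stepProb
      split_ifs <;> first | rfl | omega
    rw [h2, mul_zero, measureReal_eq_zero_iff] at h1
    simpa [ae_iff] using h1
  have hall : ∀ᵐ ω ∂P, ∀ m : ℕ, ¬ (m = g t + 1 ∨ m + 1 = g t) →
      ¬ (ω ∈ cylinder S t g ∧ S (t + 1) ω = m) := by
    refine ae_all_iff.2 fun m => ?_
    by_cases hm : m = g t + 1 ∨ m + 1 = g t
    · exact Filter.Eventually.of_forall fun ω h => absurd hm h
    · filter_upwards [hnull m hm] with ω hω _ using hω
  filter_upwards [hall] with ω hω hg
  by_contra hcon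
  exact hω (S (t + 1) ω) (by rwa [← hg t le_rfl]) ⟨hg, rfl⟩

theorem ae_le [IsProbabilityMeasure P] (hS : IsReflectedWalk P α S) :
    ∀ᵐ ω ∂P, ∀ t, S t ω ≤ t + 1 := by
  filter_upwards [hS.ae_step, hS.start] with ω hstep h0 t
  induction t with
  | zero => omega
  | succ t ih =>
    have := hstep t
    omega

theorem integrable_harmonicFn [IsProbabilityMeasure P] (hS : IsReflectedWalk P α S)
    (hα : ∀ n : ℕ, 1 ≤ n → 0 < α n ∧ α n < (1 / 2 : ℝ) * n) (t : ℕ) :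
    Integrable (fun ω => harmonicFn α (S t ω)) P := by
  refine Integrable.of_bound (C := harmonicFn α (t + 1))
    ((measurable_from_nat (f := harmonicFn α)).comp (hS.measurable t)).aestronglyMeasurable ?_
  filter_upwards [hS.ae_le] with ω hω
  rw [Real.norm_of_nonneg (harmonicFn_nonneg hα _)]
  exact (harmonicFn_strictMono hα).monotone (hω t)

theorem integrable_atZero [IsProbabilityMeasure P] (hS : IsReflectedWalk P α S) (t : ℕ) :
    Integrable (atZero S t) P := by
  refine Integrable.of_bound (C := 1) ((measurable_from_nat (f := fun n : ℕ =>
    if n = 0 then (1 : ℝ) else 0)).comp (hS.measurable t)).aestronglyMeasurable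
    (Filter.Eventually.of_forall fun ω => ?_)
  rw [Real.norm_of_nonneg (atZero_nonneg S t ω)]
  exact atZero_le_one S t ω

/-- Away from 0 this is harmonicity; at 0 the forced step raises h from 0 to 1, which is the extra
indicator. -/
theorem setIntegral_cylinder [IsProbabilityMeasure P] (hS : IsReflectedWalk P α S)
    (hα : ∀ n : ℕ, 1 ≤ n → 0 < α n ∧ α n < (1 / 2 : ℝ) * n) (t : ℕ) (g : ℕ → ℕ) :
    ∫ ω in cylinder S t g, harmonicFn α (S (t + 1) ω) ∂P =
      ∫ ω in cylinder S t g, harmonicFn α (S t ω) + atZero S t ω ∂P := by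
  have hm := hS.measurableSet_cylinder t g
  have hR : ∫ ω in cylinder S t g, harmonicFn α (S t ω) + atZero S t ω ∂P =
      P.real (cylinder S t g) * (harmonicFn α (g t) + if g t = 0 then 1 else 0) := by
    rw [setIntegral_congr_fun hm (g := fun _ => harmonicFn α (g t) + if g t = 0 then 1 else 0)
      fun ω hω => by simp only [atZero, hω t le_rfl], setIntegral_const, smul_eq_mul]
  rw [hR]
  rcases Nat.eq_zero_or_eq_succ_pred (g t) with h0 | h0
  · have : ∀ᵐ ω ∂P, ω ∈ cylinder S t g → harmonicFn α (S (t + 1) ω) = 1 := by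
      filter_upwards [hS.ae_step] with ω hω hg
      have h1 := hg t le_rfl
      have h2 : S (t + 1) ω = 1 := by
        have := hω t
        omega
      rw [h2, harmonicFn_one]
    rw [setIntegral_congr_ae hm this, setIntegral_const, h0, harmonicFn_zero]
    simp
  · set k := (g t).pred with hk
    rw [Nat.succ_eq_add_one] at h0
    have hA : ∀ m, MeasurableSet (S (t + 1) ⁻¹' {m}) :=
      fun m => hS.measurable _ (measurableSet_singleton m)
    have : ∀ᵐ ω ∂P, ω ∈ cylinder S t g → harmonicFn α (S (t + 1) ω) =
        (S (t + 1) ⁻¹' {k + 2}).indicator (fun _ => harmonicFn α (k + 2)) ω +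
        (S (t + 1) ⁻¹' {k}).indicator (fun _ => harmonicFn α k) ω := by
      filter_upwards [hS.ae_step] with ω hω hg
      have h1 := hg t le_rfl
      have h2 : S (t + 1) ω = k + 2 ∨ S (t + 1) ω = k := by
        have := hω t
        omega
      rcases h2 with h2 | h2 <;> simp [Set.indicator, h2]
    have hint : ∀ m, IntegrableOn
        ((S (t + 1) ⁻¹' {m}).indicator fun _ => harmonicFn α m) (cylinder S t g) P :=
      fun m => ((integrable_const _).indicator (hA m)).integrableOn
    have hval : ∀ m, ∫ ω in cylinder S t g,
        (S (t + 1) ⁻¹' {m}).indicator (fun _ => harmonicFn α m) ω ∂P =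
        P.real (cylinder S t g) * (stepProb α (k + 1) m * harmonicFn α m) := by
      intro m
      rw [setIntegral_indicator (hA m), setIntegral_const, smul_eq_mul, ← mul_assoc, ← h0,
        ← hS.step t g m]
      rfl
    rw [setIntegral_congr_ae hm this, integral_add (hint _) (hint _), hval, hval, h0,
      if_neg (by omega), add_zero, ← harmonicFn_harmonic hα k]
    have e1 : stepProb α (k + 1) (k + 2) = 1 / 2 + α (k + 1) / (k + 1 : ℕ) := by
      simp [stepProb]
    have e2 : stepProb α (k + 1) k = 1 / 2 - α (k + 1) / (k + 1 : ℕ) := by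
      simp [stepProb, show k ≠ k + 1 + 1 by omega]
    rw [e1, e2]
    ring

/-- The filtration generated by the walk. -/
noncomputable abbrev filtration (hS : IsReflectedWalk P α S) : Filtration ℕ m :=
  Filtration.natural S fun t => (hS.measurable t).stronglyMeasurable

theorem measurable_filtration (hS : IsReflectedWalk P α S) {s t : ℕ} (hst : s ≤ t) :
    Measurable[hS.filtration t] (S s) :=
  Measurable.mono (comap_measurable (S s))
    (le_iSup₂_of_le (f := fun j (_ : j ≤ t) => MeasurableSpace.comap (S j) _) s hst le_rfl) le_rfl

/-- Makes every event known at time t a countable disjoint union of cylinders, to which the one-step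
identity applies. -/
theorem exists_eq_preimage (hS : IsReflectedWalk P α S) {t : ℕ} {A : Set Ω}
    (hA : MeasurableSet[hS.filtration t] A) :
    ∃ B : Set (Fin (t + 1) → ℕ), (fun ω (s : Fin (t + 1)) => S s ω) ⁻¹' B = A := by
  have hle : hS.filtration t ≤
      MeasurableSpace.comap (fun ω (s : Fin (t + 1)) => S s ω) ⊤ := by
    refine iSup₂_le fun j hj => ?_
    rintro _ ⟨U, _, rfl⟩
    exact ⟨{g | g ⟨j, Nat.lt_succ_of_le hj⟩ ∈ U}, trivial, rfl⟩
  obtain ⟨B, _, hB⟩ := hle A hA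
  exact ⟨B, hB⟩

theorem setIntegral_harmonicFn_succ [IsProbabilityMeasure P] (hS : IsReflectedWalk P α S)
    (hα : ∀ n : ℕ, 1 ≤ n → 0 < α n ∧ α n < (1 / 2 : ℝ) * n) {t : ℕ} {A : Set Ω}
    (hA : MeasurableSet[hS.filtration t] A) :
    ∫ ω in A, harmonicFn α (S (t + 1) ω) ∂P =
      ∫ ω in A, harmonicFn α (S t ω) + atZero S t ω ∂P := by
  obtain ⟨B, rfl⟩ := hS.exists_eq_preimage hA
  let ext (g : B) (s : ℕ) : ℕ := if hs : s < t + 1 then g.1 ⟨s, hs⟩ else 0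
  have hmem : ∀ (g : B) (ω : Ω), ω ∈ cylinder S t (ext g) ↔
      (fun s : Fin (t + 1) => S s ω) = g := by
    intro g ω
    constructor
    · intro h
      funext s
      have := h s (Nat.le_of_lt_succ s.2)
      rwa [show ext g s = g.1 s from dif_pos s.2] at this
    · intro h s hs
      have := congrFun h ⟨s, Nat.lt_succ_of_le hs⟩
      rw [show ext g s = g.1 ⟨s, _⟩ from dif_pos (Nat.lt_succ_of_le hs)]
      exact this
  have hU : (fun ω (s : Fin (t + 1)) => S s ω) ⁻¹' B = ⋃ g : B, cylinder S t (ext g) := by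
    ext ω
    rw [Set.mem_iUnion]
    constructor
    · intro h
      exact ⟨⟨_, h⟩, (hmem _ ω).2 rfl⟩
    · rintro ⟨g, hg⟩
      rw [Set.mem_preimage, (hmem g ω).1 hg]
      exact g.2
  have hd : Pairwise (Function.onFun Disjoint fun g : B => cylinder S t (ext g)) := by
    intro g g' hne
    refine Set.disjoint_left.2 fun ω h h' => hne (Subtype.ext ?_)
    rw [← (hmem g ω).1 h, ← (hmem g' ω).1 h']
  have hm : ∀ g : B, MeasurableSet (cylinder S t (ext g)) :=
    fun g => hS.measurableSet_cylinder t _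
  rw [hU, integral_iUnion hm hd (hS.integrable_harmonicFn hα _).integrableOn,
    integral_iUnion (f := fun ω => harmonicFn α (S t ω) + atZero S t ω) hm hd
      ((hS.integrable_harmonicFn hα t).add (hS.integrable_atZero t)).integrableOn]
  exact tsum_congr fun g => hS.setIntegral_cylinder hα t _

theorem stronglyMeasurable_comp (hS : IsReflectedWalk P α S) (f : ℕ → ℝ) {s t : ℕ} (hst : s ≤ t) :
    StronglyMeasurable[hS.filtration t] (fun ω => f (S s ω)) :=
  (measurable_from_nat.comp (hS.measurable_filtration hst)).stronglyMeasurable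

theorem submartingale_harmonicFn [IsProbabilityMeasure P] (hS : IsReflectedWalk P α S)
    (hα : ∀ n : ℕ, 1 ≤ n → 0 < α n ∧ α n < (1 / 2 : ℝ) * n) :
    Submartingale (fun t ω => harmonicFn α (S t ω)) hS.filtration P := by
  refine submartingale_of_setIntegral_le_succ (fun t => hS.stronglyMeasurable_comp _ le_rfl)
    (hS.integrable_harmonicFn hα) fun t A hA => ?_
  rw [hS.setIntegral_harmonicFn_succ hα hA]
  refine integral_mono (hS.integrable_harmonicFn hα t).integrableOn
    ((hS.integrable_harmonicFn hα t).add (hS.integrable_atZero t)).integrableOn fun ω => ?_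
  exact le_add_of_nonneg_right (atZero_nonneg S t ω)

theorem martingale_harmonicFn_sub [IsProbabilityMeasure P] (hS : IsReflectedWalk P α S)
    (hα : ∀ n : ℕ, 1 ≤ n → 0 < α n ∧ α n < (1 / 2 : ℝ) * n) :
    Martingale (fun t ω => harmonicFn α (S t ω) - ∑ s ∈ Finset.range t, atZero S s ω)
      hS.filtration P := by
  have hint : ∀ t, Integrable (fun ω => ∑ s ∈ Finset.range t, atZero S s ω) P :=
    fun t => integrable_finsetSum _ fun s _ => hS.integrable_atZero s
  refine martingale_of_setIntegral_eq_succ (fun t => ?_)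
    (fun t => (hS.integrable_harmonicFn hα t).sub (hint t)) fun t A hA => ?_
  · refine (hS.stronglyMeasurable_comp _ le_rfl).sub
      (Finset.stronglyMeasurable_fun_sum _ fun s hs => ?_)
    exact hS.stronglyMeasurable_comp (fun n : ℕ => if n = 0 then (1 : ℝ) else 0)
      (Finset.mem_range.1 hs).le
  · rw [integral_sub (hS.integrable_harmonicFn hα _).integrableOn (hint _).integrableOn,
      integral_sub (hS.integrable_harmonicFn hα _).integrableOn (hint _).integrableOn,
      hS.setIntegral_harmonicFn_succ hα hA]
    simp only [Finset.sum_range_succ]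
    rw [integral_add (hS.integrable_harmonicFn hα t).integrableOn
        (hS.integrable_atZero t).integrableOn,
      integral_add (hint t).integrableOn (hS.integrable_atZero t).integrableOn]
    ring

/-! ### Transience and recurrence criteria -/

theorem ae_bddAbove_harmonicFn_iff [IsProbabilityMeasure P] (hS : IsReflectedWalk P α S)
    (hα : ∀ n : ℕ, 1 ≤ n → 0 < α n ∧ α n < (1 / 2 : ℝ) * n) :
    ∀ᵐ ω ∂P, BddAbove (Set.range fun t => harmonicFn α (S t ω)) ↔
      ∃ l, Filter.Tendsto (fun t => harmonicFn α (S t ω)) Filter.atTop (nhds l) := by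
  refine (hS.submartingale_harmonicFn hα).bddAbove_iff_exists_tendsto (R := 1) ?_
  filter_upwards [hS.ae_step] with ω hω t
  exact abs_harmonicFn_sub_le hα (hω t)

theorem isTransientWalk_of_summable [IsProbabilityMeasure P] (hS : IsReflectedWalk P α S)
    (hα : ∀ n : ℕ, 1 ≤ n → 0 < α n ∧ α n < (1 / 2 : ℝ) * n) (hsum : Summable (ratioProd α)) :
    IsTransientWalk P S := by
  filter_upwards [hS.ae_bddAbove_harmonicFn_iff hα, hS.ae_step] with ω hω hstep
  have hbdd : BddAbove (Set.range fun t => harmonicFn α (S t ω)) := by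
    refine ⟨∑' i, ratioProd α i, ?_⟩
    rintro _ ⟨t, rfl⟩
    exact hsum.sum_le_tsum _ fun i _ => (ratioProd_pos hα i).le
  obtain ⟨l, hl⟩ := hω.1 hbdd
  exact finite_setOf_eq_of_tendsto hstep (harmonicFn_strictMono hα) hl

theorem isRecurrentWalk_of_not_summable [IsProbabilityMeasure P] (hS : IsReflectedWalk P α S)
    (hα : ∀ n : ℕ, 1 ≤ n → 0 < α n ∧ α n < (1 / 2 : ℝ) * n) (hsum : ¬ Summable (ratioProd α)) :
    IsRecurrentWalk P S := by
  have hmono := harmonicFn_strictMono hα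
  have htop : Filter.Tendsto (harmonicFn α) Filter.atTop Filter.atTop :=
    (not_summable_iff_tendsto_nat_atTop_of_nonneg fun i => (ratioProd_pos hα i).le).1 hsum
  have hdiff : ∀ᵐ ω ∂P, ∀ t,
      |(harmonicFn α (S (t + 1) ω) - ∑ s ∈ Finset.range (t + 1), atZero S s ω) -
        (harmonicFn α (S t ω) - ∑ s ∈ Finset.range t, atZero S s ω)| ≤ (2 : NNReal) := by
    filter_upwards [hS.ae_step] with ω hω t
    have h1 := abs_le.1 (abs_harmonicFn_sub_le hα (hω t))
    have h2 := atZero_nonneg S t ω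
    have h3 := atZero_le_one S t ω
    rw [Finset.sum_range_succ, abs_le, NNReal.coe_ofNat]
    constructor <;> linarith
  have hmart := hS.martingale_harmonicFn_sub hα
  filter_upwards [hS.ae_bddAbove_harmonicFn_iff hα, hS.ae_step,
    hmart.bddAbove_range_iff_bddBelow_range hdiff] with ω hω hstep hbdd
  have hbound : ∀ l, Filter.Tendsto (fun t => harmonicFn α (S t ω)) Filter.atTop (nhds l) →
      ¬ ∃ B, ∀ t, S t ω ≤ B := fun l hl ⟨B, hB⟩ => not_tendsto_of_bounded hstep hmono hB l hl
  have hunbdd : ¬ ∃ B, ∀ t, S t ω ≤ B := by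
    rintro ⟨B, hB⟩
    obtain ⟨l, hl⟩ := hω.1 ⟨harmonicFn α B, by
      rintro _ ⟨t, rfl⟩
      exact hmono.monotone (hB t)⟩
    exact hbound l hl ⟨B, hB⟩
  refine infinite_setOf_eq_of_unbounded hstep ?_ (by push Not at hunbdd; exact hunbdd)
  intro hfin
  obtain ⟨M, hM⟩ : ∃ M : ℝ, ∀ t, ∑ s ∈ Finset.range t, atZero S s ω ≤ M := by
    refine ⟨∑ s ∈ hfin.toFinset, atZero S s ω, fun t => ?_⟩
    rw [← Finset.sum_filter_ne_zero]
    refine Finset.sum_le_sum_of_subset_of_nonneg (fun s hs => ?_)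
      fun s _ _ => atZero_nonneg S s ω
    have := (Finset.mem_filter.1 hs).2
    rw [Set.Finite.mem_toFinset]
    by_contra hne
    exact this (if_neg hne)
  -- Since h ≥ 0 and there are at most M visits to 0, the martingale stays above -M; bounded
  -- differences then give an upper bound U.
  obtain ⟨U, hU⟩ := hbdd.2 ⟨-M, by
    rintro _ ⟨t, rfl⟩
    have := harmonicFn_nonneg hα (S t ω)
    have := hM t
    simp only
    linarith⟩
  obtain ⟨B, hB⟩ := (htop.eventually_gt_atTop (U + M)).exists
  refine hunbdd ⟨B, fun t => ?_⟩
  by_contra hlt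
  have h1 := hmono.monotone (not_le.1 hlt).le
  have h2 : harmonicFn α (S t ω) - ∑ s ∈ Finset.range t, atZero S s ω ≤ U := hU ⟨t, rfl⟩
  linarith [hM t]

end IsReflectedWalk

theorem theorem4 {Ω : Type*} [MeasurableSpace Ω] (P : Measure Ω) [IsProbabilityMeasure P]
    (S : ℕ → Ω → ℕ) (α : ℕ → ℝ) (C : ℝ) (hC : 0 < C)
    (hα : ∀ n : ℕ, 1 ≤ n → 0 < α n ∧ α n < min C ((1 / 2 : ℝ) * n))
    (hS : IsReflectedWalk P α S) :
    ((∃ (c : ℝ) (K n₀ : ℕ), 1 < c ∧ 1 ≤ K ∧ ∀ n : ℕ, n₀ < n →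
        (1 / 4 : ℝ) * (1 + ∑ k ∈ Finset.Icc 1 (K - 1), 1 / logProd k n + c / logProd K n) ≤ α n) →
      IsTransientWalk P S) ∧
    ((∃ K n₀ : ℕ, 1 ≤ K ∧ ∀ n : ℕ, n₀ < n →
        α n ≤ (1 / 4 : ℝ) * (1 + ∑ k ∈ Finset.Icc 1 K, 1 / logProd k n)) →
      IsRecurrentWalk P S) := by
  have hα' : ∀ n : ℕ, 1 ≤ n → 0 < α n ∧ α n < (1 / 2 : ℝ) * n :=
    fun n hn => ⟨(hα n hn).1, (hα n hn).2.trans_le (min_le_right _ _)⟩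
  constructor
  · rintro ⟨c, K, n₀, hc, hK, h⟩
    obtain ⟨K, rfl⟩ := Nat.exists_eq_add_of_le' hK
    exact hS.isTransientWalk_of_summable hα' (summable_ratioProd hα' hc h)
  · rintro ⟨K, n₀, hK, h⟩
    obtain ⟨K, rfl⟩ := Nat.exists_eq_add_of_le' hK
    refine hS.isRecurrentWalk_of_not_summable hα' (not_summable_ratioProd (C := C) hα'
      (fun n hn => ((hα n hn).2.trans_le (min_le_left _ _)).le) (n₀ := n₀) (K := K) fun n hn => ?_)
    -- With c = 1 the last term of the critical drift is the next term of the sum.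
    rw [critDrift, add_assoc, ← Finset.sum_Icc_succ_top (by omega)]
    exact h n hn
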